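/- Let $G$ be a finite group and let $\mathfrak{D}(G)$ denote the smallest dimension of a non-trivial irreducible complex representation of $G$ (with $\mathfrak{D}(G)=0$ if $G$ is the trivial group). For $S\subseteq G$ with $S=S^{-1}$, let $\mathrm{Cay}(G,S)$ be the Cayley graph with vertex set $G$ in which $g$ and $h$ are joined by an edge if and only if $gs=h$ for some $s\in S$, and let its adjacency operator act on $\ell^2(G)$ (complex functions on $G$, counting measure) by $\mathcal{A}\varphi(g)=\sum_{s\in S}\varphi(gs)$. For $\varphi\in\ell^2(G)$ with $\|\varphi\|_{\ell^2}=1$, let $\mu_\varphi=\sum_{g\in G}|\varphi(g)|^2\delta_g$, and write $\mu_\varphi[f]=\sum_{g\in G}|\varphi(g)|^2f(g)$. Let $\varepsilon>0$ and suppose that $\mathfrak{D}(G)\ge\log^2(|G|)$. Let $S\subseteq G$ be a symmetric subset and $\mathcal{G}=\mathrm{Cay}(G,S)$. Then, given $M\in\mathbb{N}$ satisfying $$M\le\min\left(\frac{1}{24}|G|^{\varepsilon},\ \frac{1}{8}|G|^{-1}e^{\mathfrak{D}(G)/12}\right)$$ and functions $f_1,\dots,f_M:G\to\mathbb{R}$,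 there exists an orthonormal basis $\mathcal{B}$ of $\ell^2(G)$ consisting of real-valued eigenfunctions of the adjacency operator of $\mathcal{G}$ such that for every $\varphi\in\mathcal{B}$ and every $i=1,\dots,M$, $$\left|\mu_\varphi[f_i]-\frac{\sum_{g\in G}f_i(g)}{|G|}\right|\le 64\,\frac{(\varepsilon+1)\log(|G|)}{\sqrt{\mathfrak{D}(G)}}\,\frac{\|f_i\|_{\ell^2}}{\sqrt{|G|}}.$$ -/

import Mathlib

open scoped BigOperators

noncomputable section

namespace CayleyQUE

universe u

/-- The set of dimensions of the non-trivial irreducible (finite-dimensional) complex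
representations of `G`. -/
def nontrivialIrrepDims (G : Type u) [Group G] : Set ℕ :=
  {d | ∃ (V : Type u) (_ : AddCommGroup V) (_ : Module ℂ V) (ρ : Representation ℂ G V),
    FiniteDimensional ℂ V ∧ ρ.IsIrreducible ∧ ¬ ρ.IsTrivial ∧ Module.finrank ℂ V = d}

/-- `𝔇(G)`: the smallest dimension of a non-trivial irreducible complex representation of `G`.
(For the trivial group there is no such representation, and the value is `0`.) -/
def minRepDim (G : Type u) [Group G] : ℕ :=
  sInf (nontrivialIrrepDims G)

/-- The Cayley graph `Cay(G, S)`: there is an edge from `g` to `h` iff `g * s = h` for some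
`s ∈ S`. The edge relation is symmetric when `S = S⁻¹`; if `1 ∈ S`, every vertex has a loop. -/
def cayleyGraph {G : Type*} [Group G] (S : Set G) : Digraph G where
  Adj g h := ∃ s ∈ S, g * s = h

open Classical in
/-- The adjacency operator on `ℓ²(V)` (counting measure): the operator whose matrix has entry `1`
at `(x, y)` if there is an edge from `x` to `y`, and `0` otherwise. -/
def adjacencyOperator {V : Type*} [Fintype V] (Γ : Digraph V) :
    EuclideanSpace ℂ V →ₗ[ℂ] EuclideanSpace ℂ V :=
  Matrix.toEuclideanLin (Matrix.of fun x y : V => if Γ.Adj x y then (1 : ℂ) else 0)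

open Classical in
/-- On a Cayley graph, `(𝒜 f)(g) = ∑_{s ∈ S} f(g s)`. -/
theorem adjacencyOperator_cayleyGraph_apply {G : Type*} [Group G] [Fintype G] (S : Set G)
    (f : EuclideanSpace ℂ G) (g : G) :
    adjacencyOperator (cayleyGraph S) f g = ∑ s : G, if s ∈ S then f (g * s) else 0 := by
  have h : adjacencyOperator (cayleyGraph S) f g
      = ∑ y : G, (if (cayleyGraph S).Adj g y then (1 : ℂ) else 0) * f y := rfl
  rw [h, ← Equiv.sum_comp (Equiv.mulLeft g)]
  refine Finset.sum_congr rfl fun s _ => ?_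
  have h2 : (cayleyGraph S).Adj g (g * s) ↔ s ∈ S := by simp [cayleyGraph]
  simp [h2]

/-- The quantum probability measure `μ_φ = ∑_v |φ(v)|² δ_v` on the (finite, discrete) set `V`. -/
def quantumMeasure {V : Type*} [Fintype V] (φ : EuclideanSpace ℂ V) :
    @MeasureTheory.Measure V ⊤ :=
  ∑ v : V, ENNReal.ofReal (‖φ v‖ ^ 2) • @MeasureTheory.Measure.dirac V ⊤ v

/-- `μ_φ[f]`, the integral of `f` against the quantum probability measure of `φ`. -/
def quantumMean {V : Type*} [Fintype V] (φ : EuclideanSpace ℂ V) (f : V → ℝ) : ℝ :=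
  @MeasureTheory.integral V ℝ _ _ ⊤ (quantumMeasure φ) f

/-- `μ_φ[f] = ∑_v |φ(v)|² f(v)`. -/
theorem quantumMean_eq_sum {V : Type*} [Fintype V] (φ : EuclideanSpace ℂ V) (f : V → ℝ) :
    quantumMean φ f = ∑ v : V, ‖φ v‖ ^ 2 * f v := by
  let _ : MeasurableSpace V := ⊤
  unfold quantumMean quantumMeasure
  rw [MeasureTheory.integral_finsetSum_measure]
  · refine Finset.sum_congr rfl fun v _ => ?_
    rw [MeasureTheory.integral_smul_measure, MeasureTheory.integral_dirac,
      ENNReal.toReal_ofReal (by positivity), smul_eq_mul]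
  · intro v _
    exact (MeasureTheory.integrable_dirac (by simp)).smul_measure ENNReal.ofReal_ne_top

/-- The `ℓ²` norm of a real function with respect to the counting measure. -/
def l2Norm {V : Type*} [Fintype V] (f : V → ℝ) : ℝ :=
  Real.sqrt (∑ v : V, f v ^ 2)

/-- `B` consists of real-valued eigenfunctions of the linear operator `T` on `ℓ²(V)`. -/
def IsRealEigenbasis {V ι : Type*} [Fintype V] [Fintype ι]
    (T : EuclideanSpace ℂ V →ₗ[ℂ] EuclideanSpace ℂ V)
    (B : OrthonormalBasis ι ℂ (EuclideanSpace ℂ V)) : Prop :=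
  ∀ b : ι, (∀ v : V, (B b v).im = 0) ∧ ∃ μ : ℂ, Module.End.HasEigenvector T μ (B b)

end CayleyQUE

end

open scoped BigOperators

noncomputable section

namespace CayleyQUE

universe u

/-! Left translations commute with both the adjacency operator and the all-ones operator `J`, so
every joint eigenspace `W` is translation invariant. Where `J` has a nonzero eigenvalue, `W`
consists of constants and equidistribution is exact. Where `J` vanishes, functions in `W` have sum
zero. If `W` is nonzero, its complexification therefore contains a non-trivial irreducible
representation, and `d = dim W` is at least `𝔇(G)` (`minRepDim_le_finrank`).

Translation invariance also makes the diagonal of the projection onto `W` constant, equal to `d/|G|`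
(`sum_sq_orthonormalBasis_eq`). Hence each form `v ↦ ∑ (f - mean f) v²` on `W` has trace zero and
Hilbert-Schmidt norm at most `‖f‖ √(d/|G|)`. It remains to find an orthonormal basis of `W` in which
all these forms have diagonal entries `O(log |G| / d)` times that norm
(`exists_orthogonal_diag_le`).

Such a basis comes from a flat real orthogonal matrix, the Hartley transform, with random column
signs. The off-diagonal part of a rotated diagonal entry is a Rademacher chaos of degree two,
controlled for all forms and basis vectors at once by exponential moments (`sum_exp_chaos_le`) and a
union bound. The signs do not affect the diagonal part, which is a sine transform of the old
diagonal. A second rotation makes this harmless, because the sine transform applied twice is almost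
diagonal (`exists_orthogonal_diag_le_of_unit`). -/

/-! ### Exponential moments of Rademacher sums and chaoses. -/

/-- The sign `±1` attached to a Boolean. -/
def boolSign (b : Bool) : ℝ := if b then 1 else -1

@[simp] lemma boolSign_true : boolSign true = 1 := rfl
@[simp] lemma boolSign_false : boolSign false = -1 := rfl

lemma boolSign_mul_self (b : Bool) : boolSign b * boolSign b = 1 := by cases b <;> simp

lemma sum_exp_sign_le {ι : Type*} [Fintype ι] [DecidableEq ι] (b : ι → ℝ) :
    ∑ s : ι → Bool, Real.exp (∑ k, boolSign (s k) * b k)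
      ≤ 2 ^ Fintype.card ι * Real.exp ((∑ k, b k ^ 2) / 2) := by
  have h1 : ∑ s : ι → Bool, Real.exp (∑ k, boolSign (s k) * b k)
      = ∏ k, (2 * Real.cosh (b k)) := by
    have := Finset.prod_univ_sum (fun _ : ι => (Finset.univ : Finset Bool))
      (fun k c => Real.exp (boolSign c * b k))
    rw [Fintype.piFinset_univ] at this
    simp_rw [Real.exp_sum, ← this, Fintype.sum_bool, Real.cosh_eq]
    refine Finset.prod_congr rfl fun k _ => ?_
    simp
    ring
  rw [h1, Finset.prod_mul_distrib, Finset.prod_const, Finset.sum_div, Real.exp_sum,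
    Finset.card_univ]
  gcongr with k
  · exact Real.cosh_le_exp_half_sq _

/-- Gaussian linearisation: a squared Rademacher sum in the exponent becomes linear, so the
sub-Gaussian bound applies. -/
lemma exp_sq_eq_integral (y : ℝ) :
    Real.exp (y ^ 2 / 2) = ∫ g, Real.exp (y * g) ∂(ProbabilityTheory.gaussianReal 0 1) := by
  have := congrFun (ProbabilityTheory.mgf_id_gaussianReal (μ := 0) (v := 1)) y
  simp only [ProbabilityTheory.mgf, id] at this
  rw [this]; simp

/-- The integral is `(1 - c)^(-1/2)`; the threshold `3/4` is exactly where this reaches `2`. -/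
lemma integral_exp_sq_gaussianReal {c : ℝ} (hc : c ≤ 3 / 4) :
    MeasureTheory.Integrable (fun g => Real.exp (c * g ^ 2 / 2))
      (ProbabilityTheory.gaussianReal 0 1) ∧
    ∫ g, Real.exp (c * g ^ 2 / 2) ∂(ProbabilityTheory.gaussianReal 0 1) ≤ 2 := by
  have hfun : ∀ g : ℝ, ProbabilityTheory.gaussianPDFReal 0 1 g * Real.exp (c * g ^ 2 / 2)
      = (Real.sqrt (2 * Real.pi))⁻¹ * Real.exp (-((1 - c) / 2) * g ^ 2) := by
    intro g
    simp only [ProbabilityTheory.gaussianPDFReal, NNReal.coe_one, mul_one, sub_zero]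
    rw [mul_assoc, ← Real.exp_add]
    congr 2
    ring
  have hpos : 0 < (1 - c) / 2 := by linarith
  constructor
  · rw [ProbabilityTheory.gaussianReal_of_var_ne_zero 0 (by norm_num : (1 : NNReal) ≠ 0)]
    rw [MeasureTheory.integrable_withDensity_iff_integrable_smul'
      (ProbabilityTheory.measurable_gaussianPDF 0 1)
      (Filter.Eventually.of_forall fun _ => ProbabilityTheory.gaussianPDF_lt_top)]
    simp only [ProbabilityTheory.toReal_gaussianPDF, smul_eq_mul, hfun]
    exact (integrable_exp_neg_mul_sq hpos).const_mul _
  · rw [ProbabilityTheory.integral_gaussianReal_eq_integral_smul (by norm_num)]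
    simp only [smul_eq_mul, hfun]
    rw [MeasureTheory.integral_const_mul, integral_gaussian, ← Real.sqrt_inv,
      ← Real.sqrt_mul (by positivity)]
    apply Real.sqrt_le_iff.2 ⟨by norm_num, ?_⟩
    have : (2 * Real.pi)⁻¹ * (Real.pi / ((1 - c) / 2)) = 1 / (1 - c) := by
      have := Real.pi_pos.ne'
      have : 1 - c ≠ 0 := by linarith
      field_simp
    rw [this, div_le_iff₀ (by linarith)]
    linarith

lemma sum_exp_sq_sign_le {ι : Type*} [Fintype ι] [DecidableEq ι] (y : ι → ℝ)
    (hy : ∑ k, y k ^ 2 ≤ 3 / 4) :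
    ∑ s : ι → Bool, Real.exp ((∑ k, boolSign (s k) * y k) ^ 2 / 2)
      ≤ 2 ^ Fintype.card ι * 2 := by
  simp_rw [exp_sq_eq_integral]
  have hint : ∀ t : ℝ, MeasureTheory.Integrable (fun g => Real.exp (t * g))
      (ProbabilityTheory.gaussianReal 0 1) := fun t =>
    ProbabilityTheory.integrable_exp_mul_gaussianReal t
  obtain ⟨hi, hb⟩ := integral_exp_sq_gaussianReal hy
  rw [← MeasureTheory.integral_finsetSum _ fun s _ => hint _]
  calc _ ≤ ∫ g, 2 ^ Fintype.card ι * Real.exp ((∑ k, y k ^ 2) * g ^ 2 / 2)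
        ∂(ProbabilityTheory.gaussianReal 0 1) := by
        refine MeasureTheory.integral_mono (MeasureTheory.integrable_finsetSum _ fun s _ => hint _)
          (hi.const_mul _) fun g => ?_
        have := sum_exp_sign_le (fun k => y k * g)
        simp only [mul_pow, ← mul_assoc, ← Finset.sum_mul] at this
        exact this
    _ ≤ _ := by
        rw [MeasureTheory.integral_const_mul]
        gcongr

/-- Convexity of `exp` with weights `w k / W` reduces to a single linear form: each row is rescaled
to have the total square sum `W`. -/
lemma sum_exp_sum_sq_sign_le {κ ι : Type*} [Fintype κ] [Fintype ι] [DecidableEq ι]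
    (a : κ → ι → ℝ) (ha : ∑ k, ∑ l, a k l ^ 2 ≤ 3 / 4) :
    ∑ s : ι → Bool, Real.exp ((∑ k, (∑ l, boolSign (s l) * a k l) ^ 2) / 2)
      ≤ 2 ^ Fintype.card ι * 2 := by
  set w : κ → ℝ := fun k => ∑ l, a k l ^ 2 with hw
  have hw0 : ∀ k, 0 ≤ w k := fun k => Finset.sum_nonneg fun l _ => sq_nonneg _
  have hzero : ∀ k, w k = 0 → ∀ l, a k l = 0 := fun k hk l => by
    have := (Finset.sum_eq_zero_iff_of_nonneg (fun l _ => sq_nonneg (a k l))).1 hk l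
      (Finset.mem_univ l)
    simpa using this
  set W := ∑ k, w k with hW
  have hW0 : 0 ≤ W := Finset.sum_nonneg fun k _ => hw0 k
  rcases hW0.eq_or_lt with h | hWpos
  · have h0 : ∀ k l, a k l = 0 := fun k =>
      hzero k ((Finset.sum_eq_zero_iff_of_nonneg (fun k _ => hw0 k)).1 h.symm k (Finset.mem_univ k))
    simp [h0]
  · have key : ∀ s : ι → Bool, Real.exp ((∑ k, (∑ l, boolSign (s l) * a k l) ^ 2) / 2)
        ≤ ∑ k, (w k / W) * Real.exp
          ((∑ l, boolSign (s l) * (Real.sqrt (W / w k) * a k l)) ^ 2 / 2) := by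
      intro s
      have hj := convexOn_exp.map_sum_le (t := Finset.univ) (w := fun k => w k / W)
        (p := fun k => (∑ l, boolSign (s l) * (Real.sqrt (W / w k) * a k l)) ^ 2 / 2)
        (fun k _ => div_nonneg (hw0 k) hW0)
        (by rw [← Finset.sum_div]; exact div_self hWpos.ne') (fun _ _ => Set.mem_univ _)
      simp only [smul_eq_mul] at hj
      refine le_of_eq_of_le ?_ hj
      congr 1
      rw [Finset.sum_div]
      refine Finset.sum_congr rfl fun k _ => ?_
      have : ∑ l, boolSign (s l) * (Real.sqrt (W / w k) * a k l)
          = Real.sqrt (W / w k) * ∑ l, boolSign (s l) * a k l := by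
        rw [Finset.mul_sum]
        exact Finset.sum_congr rfl fun l _ => by ring
      rw [this, mul_pow, Real.sq_sqrt (div_nonneg hW0 (hw0 k))]
      -- For a zero row, `W / w k` is `0` by convention, and both sides vanish.
      by_cases hk : w k = 0
      · simp [hzero k hk]
      · field_simp
    refine (Finset.sum_le_sum fun s _ => key s).trans ?_
    rw [Finset.sum_comm]
    have : ∀ k, ∑ s : ι → Bool, (w k / W) * Real.exp
          ((∑ l, boolSign (s l) * (Real.sqrt (W / w k) * a k l)) ^ 2 / 2)
        ≤ (w k / W) * (2 ^ Fintype.card ι * 2) := by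
      intro k
      rw [← Finset.mul_sum]
      refine mul_le_mul_of_nonneg_left (sum_exp_sq_sign_le _ ?_) (div_nonneg (hw0 k) hW0)
      simp_rw [mul_pow, ← Finset.mul_sum, Real.sq_sqrt (div_nonneg hW0 (hw0 k))]
      by_cases hk : w k = 0
      · norm_num [hk]
      · exact (div_mul_cancel₀ W hk).le.trans ha
    refine (Finset.sum_le_sum fun k _ => this k).trans ?_
    rw [← Finset.sum_mul, ← Finset.sum_div, ← hW, div_self hWpos.ne', one_mul]

/-- For fixed `s'` the exponent is linear in `s`; summing over `s` leaves a sum of squares of linear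
forms in `s'`. -/
lemma sum_sum_exp_bilin_sign_le {κ ι : Type*} [Fintype κ] [Fintype ι] [DecidableEq κ]
    [DecidableEq ι] (a : κ → ι → ℝ) (ha : ∑ k, ∑ l, a k l ^ 2 ≤ 3 / 4) :
    ∑ s' : ι → Bool, ∑ s : κ → Bool,
        Real.exp (∑ k, boolSign (s k) * ∑ l, boolSign (s' l) * a k l)
      ≤ 2 ^ Fintype.card κ * (2 ^ Fintype.card ι * 2) := by
  refine (Finset.sum_le_sum fun s' _ => sum_exp_sign_le _).trans ?_
  rw [← Finset.mul_sum]
  gcongr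
  exact sum_exp_sum_sq_sign_le a ha

/-- Exchanging the coordinates selected by `t` in a pair of functions. -/
def swapEquiv {ι α : Type*} (t : ι → Bool) : (ι → α) × (ι → α) ≃ (ι → α) × (ι → α) where
  toFun p := (fun k => if t k then p.1 k else p.2 k, fun k => if t k then p.2 k else p.1 k)
  invFun p := (fun k => if t k then p.1 k else p.2 k, fun k => if t k then p.2 k else p.1 k)
  left_inv p := by ext k <;> by_cases h : t k <;> simp [h]
  right_inv p := by ext k <;> by_cases h : t k <;> simp [h]

/-- The weight is nonzero only if `t k` is true and `t l` is false, so the two sign factors use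
disjoint coordinates. They may thus be drawn from independent sign vectors, which `swapEquiv`
recombines into one. -/
lemma sum_exp_decoupled_le {ι : Type*} [Fintype ι] [DecidableEq ι] (a : ι → ι → ℝ)
    (ha : 16 * ∑ k, ∑ l, a k l ^ 2 ≤ 3 / 4) (t : ι → Bool) :
    ∑ s : ι → Bool, Real.exp (∑ k, ∑ l, (1 + boolSign (t k)) * (1 - boolSign (t l)) *
        (a k l * (boolSign (s k) * boolSign (s l)))) ≤ 2 ^ Fintype.card ι * 2 := by
  set F : (ι → Bool) → ℝ := fun s => Real.exp (∑ k, ∑ l, (1 + boolSign (t k)) *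
    (1 - boolSign (t l)) * (a k l * (boolSign (s k) * boolSign (s l)))) with hF
  have h1 : ∑ p : (ι → Bool) × (ι → Bool), F (swapEquiv t p).1
      = 2 ^ Fintype.card ι * ∑ s, F s := by
    rw [Equiv.sum_comp (swapEquiv t) (fun p => F p.1), Fintype.sum_prod_type, Finset.mul_sum]
    simp
  have h2 := sum_sum_exp_bilin_sign_le
    (fun k l => (1 + boolSign (t k)) * (1 - boolSign (t l)) * a k l) (by
      refine le_trans ?_ ha
      simp_rw [Finset.mul_sum]
      refine Finset.sum_le_sum fun k _ => Finset.sum_le_sum fun l _ => ?_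
      -- The weight takes only the values `0` and `4`, whence the factor `16`.
      have : 0 ≤ a k l ^ 2 := sq_nonneg _
      cases t k <;> cases t l <;> simp <;> nlinarith)
  rw [Finset.sum_comm, ← Fintype.sum_prod_type'] at h2
  have h3 : ∀ p : (ι → Bool) × (ι → Bool), Real.exp (∑ k, boolSign (p.1 k) *
      ∑ l, boolSign (p.2 l) * ((1 + boolSign (t k)) * (1 - boolSign (t l)) * a k l))
      = F (swapEquiv t p).1 := by
    intro p
    simp only [hF, swapEquiv, Equiv.coe_fn_mk]
    congr 1
    refine Finset.sum_congr rfl fun k _ => ?_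
    rw [Finset.mul_sum]
    refine Finset.sum_congr rfl fun l _ => ?_
    cases t k <;> cases t l <;> simp
    ring
  simp_rw [h3] at h2
  rw [h1] at h2
  exact le_of_mul_le_mul_left h2 (by positivity)

lemma sum_boolSign_pair {ι : Type*} [Fintype ι] [DecidableEq ι] (k l : ι) :
    ∑ t : ι → Bool, (1 + boolSign (t k)) * (1 - boolSign (t l))
      = if k = l then 0 else 2 ^ Fintype.card ι := by
  split_ifs with h
  · subst h
    refine Finset.sum_eq_zero fun t _ => ?_
    cases t k <;> simp
  · have flip : ∀ m : ι, ∀ g : (ι → Bool) → ℝ, (∀ t, g (Function.update t m (!t m)) = - g t) →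
        ∑ t, g t = 0 := by
      intro m g hg
      have e : Function.Involutive fun t : ι → Bool => Function.update t m (!t m) := by
        intro t; simp
      have := Equiv.sum_comp e.toPerm g
      simp only [Function.Involutive.coe_toPerm, hg, Finset.sum_neg_distrib] at this
      linarith
    have neg : ∀ b, boolSign (!b) = - boolSign b := by intro b; cases b <;> simp
    have h1 : ∑ t : ι → Bool, boolSign (t k) = 0 := flip k _ fun t => by simp [neg]
    have h2 : ∑ t : ι → Bool, boolSign (t l) = 0 := flip l _ fun t => by simp [neg]
    have h3 : ∑ t : ι → Bool, boolSign (t k) * boolSign (t l) = 0 :=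
      flip k _ fun t => by simp [neg, Function.update_of_ne (Ne.symm h)]
    have : ∀ t : ι → Bool, (1 + boolSign (t k)) * (1 - boolSign (t l))
      = 1 + boolSign (t k) - boolSign (t l) - boolSign (t k) * boolSign (t l) := fun t => by ring
    simp_rw [this, Finset.sum_sub_distrib, Finset.sum_add_distrib, h1, h2, h3]
    simp

/-- Exponential moment bound for an off-diagonal Rademacher chaos of degree two. -/
lemma sum_exp_chaos_le {ι : Type*} [Fintype ι] [DecidableEq ι] (a : ι → ι → ℝ)
    (ha : 16 * ∑ k, ∑ l, a k l ^ 2 ≤ 3 / 4) :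
    ∑ s : ι → Bool, Real.exp (∑ k, ∑ l, if k = l then 0 else
        a k l * (boolSign (s k) * boolSign (s l))) ≤ 2 ^ Fintype.card ι * 2 := by
  set C : ℝ := 2 ^ Fintype.card ι with hC
  have hC0 : 0 < C := by positivity
  have key : ∀ s : ι → Bool, Real.exp (∑ k, ∑ l, if k = l then 0 else
        a k l * (boolSign (s k) * boolSign (s l))) ≤
      ∑ t : ι → Bool, C⁻¹ * Real.exp (∑ k, ∑ l, (1 + boolSign (t k)) * (1 - boolSign (t l)) *
        (a k l * (boolSign (s k) * boolSign (s l)))) := by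
    intro s
    -- Averaged over `t`, the weights are `1` off the diagonal and `0` on it, so Jensen bounds the
    -- chaos by its decoupled versions.
    have hj := convexOn_exp.map_sum_le (t := Finset.univ) (w := fun _ : ι → Bool => C⁻¹)
      (p := fun t => ∑ k, ∑ l, (1 + boolSign (t k)) * (1 - boolSign (t l)) *
        (a k l * (boolSign (s k) * boolSign (s l))))
      (fun _ _ => by positivity) (by simp [hC]) (fun _ _ => Set.mem_univ _)
    simp only [smul_eq_mul] at hj
    refine le_of_eq_of_le ?_ hj
    congr 1
    rw [← Finset.mul_sum, Finset.sum_comm (s := (Finset.univ : Finset (ι → Bool))),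
      Finset.mul_sum]
    refine Finset.sum_congr rfl fun k _ => ?_
    rw [Finset.sum_comm (s := (Finset.univ : Finset (ι → Bool))), Finset.mul_sum]
    refine Finset.sum_congr rfl fun l _ => ?_
    rw [← Finset.sum_mul, sum_boolSign_pair]
    split_ifs
    · simp
    · rw [← hC]; field_simp
  refine (Finset.sum_le_sum fun s _ => key s).trans ?_
  rw [Finset.sum_comm]
  simp_rw [← Finset.mul_sum]
  have := Finset.sum_le_sum fun t (_ : t ∈ Finset.univ) => sum_exp_decoupled_le a ha t
  calc _ ≤ C⁻¹ * ∑ t : ι → Bool, C * 2 := by gcongr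
    _ = C * 2 := by
      simp only [Finset.sum_const, Finset.card_univ, Fintype.card_fun, Fintype.card_bool,
        nsmul_eq_mul]
      push_cast
      rw [← hC]; field_simp

/-! ### The discrete Hartley transform and its sine sums. -/

/-- `cos (2πx/d)` for `x` an integer modulo `d`. -/
def zmodCos {d : ℕ} [NeZero d] (x : ZMod d) : ℝ := (ZMod.stdAddChar x).re

/-- `sin (2πx/d)` for `x` an integer modulo `d`. -/
def zmodSin {d : ℕ} [NeZero d] (x : ZMod d) : ℝ := (ZMod.stdAddChar x).im

section Hartley

variable {d : ℕ} [NeZero d]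

lemma zmodCos_add (x y : ZMod d) :
    zmodCos (x + y) = zmodCos x * zmodCos y - zmodSin x * zmodSin y := by
  simp [zmodCos, zmodSin, AddChar.map_add_eq_mul]

lemma zmodSin_add (x y : ZMod d) :
    zmodSin (x + y) = zmodCos x * zmodSin y + zmodSin x * zmodCos y := by
  simp [zmodCos, zmodSin, AddChar.map_add_eq_mul]

lemma zmodCos_neg (x : ZMod d) : zmodCos (-x) = zmodCos x := by
  simp [zmodCos, AddChar.map_neg_eq_conj]

lemma zmodSin_neg (x : ZMod d) : zmodSin (-x) = -zmodSin x := by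
  simp [zmodSin, AddChar.map_neg_eq_conj]

lemma zmodCos_sq_add_zmodSin_sq (x : ZMod d) : zmodCos x ^ 2 + zmodSin x ^ 2 = 1 := by
  have h := zmodCos_add x (-x)
  rw [zmodCos_neg, zmodSin_neg, add_neg_cancel] at h
  have h0 : zmodCos (0 : ZMod d) = 1 := by simp [zmodCos]
  rw [h0] at h
  linarith

lemma abs_zmodSin_le_one (x : ZMod d) : |zmodSin x| ≤ 1 :=
  abs_le_one_iff_mul_self_le_one.2 (by
    nlinarith [zmodCos_sq_add_zmodSin_sq x, sq_nonneg (zmodCos x)])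

lemma sum_zmodCos_mul (b : ZMod d) :
    ∑ x : ZMod d, zmodCos (x * b) = if b = 0 then (d : ℝ) else 0 := by
  have := congrArg Complex.re (AddChar.sum_mulShift b (ZMod.isPrimitive_stdAddChar d))
  rw [Complex.re_sum, ZMod.card] at this
  simp only [zmodCos]
  rw [this]
  split_ifs <;> simp

lemma sum_zmodSin_mul (b : ZMod d) : ∑ x : ZMod d, zmodSin (x * b) = 0 := by
  have := congrArg Complex.im (AddChar.sum_mulShift b (ZMod.isPrimitive_stdAddChar d))
  rw [Complex.im_sum, ZMod.card] at this
  simp only [zmodSin]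
  rw [this]
  split_ifs <;> simp

variable (d) in
/-- The matrix of the discrete Hartley transform: a real orthogonal matrix with entries of size
`O(d^{-1/2})`. -/
def hartley : Matrix (ZMod d) (ZMod d) ℝ :=
  Matrix.of fun j k => (zmodCos (j * k) + zmodSin (j * k)) / Real.sqrt d

/-- This is `(cos θ + sin θ)² = 1 + sin 2θ`; the sine term is what makes a second rotation
necessary. -/
lemma hartley_sq (j k : ZMod d) : hartley d j k ^ 2 = (1 + zmodSin (2 * (j * k))) / d := by
  rw [hartley, Matrix.of_apply, div_pow, Real.sq_sqrt (Nat.cast_nonneg d), two_mul, zmodSin_add]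
  congr 1
  linarith [zmodCos_sq_add_zmodSin_sq (j * k)]

lemma hartley_sq_le (j k : ZMod d) : hartley d j k ^ 2 ≤ 2 / d := by
  rw [hartley_sq]
  gcongr
  linarith [(abs_le.1 (abs_zmodSin_le_one (2 * (j * k)))).2]

lemma hartley_mul_transpose : hartley d * (hartley d).transpose = 1 := by
  ext i j
  have hd : (d : ℝ) ≠ 0 := Nat.cast_ne_zero.2 (NeZero.ne d)
  have h : ∀ k : ZMod d, hartley d i k * hartley d j k
      = (zmodCos (k * (i - j)) + zmodSin (k * (i + j))) / d := by
    intro k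
    have h1 : k * (i - j) = i * k + -(j * k) := by ring
    have h2 : k * (i + j) = i * k + j * k := by ring
    rw [hartley, Matrix.of_apply, Matrix.of_apply, div_mul_div_comm,
      Real.mul_self_sqrt (Nat.cast_nonneg d), h1, h2, zmodCos_add, zmodSin_add, zmodCos_neg,
      zmodSin_neg]
    ring
  simp only [Matrix.mul_apply, Matrix.transpose_apply, h, ← Finset.sum_div,
    Finset.sum_add_distrib, sum_zmodCos_mul, sum_zmodSin_mul, sub_eq_zero, Matrix.one_apply]
  split_ifs <;> simp [hd]

lemma sum_ite_two_mul_eq_zero_le :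
    ∑ k : ZMod d, (if 2 * k = 0 then (1 : ℝ) else 0) ≤ 2 := by
  have := IsAddCyclic.card_nsmul_eq_zero_le (α := ZMod d) (n := 2) (by norm_num)
  simp only [nsmul_eq_mul, Nat.cast_ofNat] at this
  rw [Finset.sum_boole]
  exact_mod_cast this

lemma abs_sum_zmodSin_mul_zmodSin_le (m k : ZMod d) :
    |∑ j : ZMod d, zmodSin (2 * (m * j)) * zmodSin (2 * (j * k))|
      ≤ d / 2 * ((if 2 * (m - k) = 0 then 1 else 0) + if 2 * (m + k) = 0 then 1 else 0) := by
  have h : ∀ j : ZMod d, zmodSin (2 * (m * j)) * zmodSin (2 * (j * k))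
      = (zmodCos (j * (2 * (m - k))) - zmodCos (j * (2 * (m + k)))) / 2 := by
    intro j
    have h1 : j * (2 * (m - k)) = 2 * (m * j) + -(2 * (j * k)) := by ring
    have h2 : j * (2 * (m + k)) = 2 * (m * j) + 2 * (j * k) := by ring
    rw [h1, h2, zmodCos_add, zmodCos_add, zmodCos_neg, zmodSin_neg]
    ring
  simp_rw [h, ← Finset.sum_div, Finset.sum_sub_distrib, sum_zmodCos_mul]
  have hd : (0 : ℝ) ≤ d := Nat.cast_nonneg d
  rw [abs_div, abs_two]
  split_ifs <;> (simp; try linarith)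

/-- By orthogonality, the kernel of the twice-applied sine transform is supported on `2k = ±2m`.
Each sign gives at most two `k`, and each contributes at most `d/2`. -/
lemma abs_sum_sum_zmodSin_le {v : ZMod d → ℝ} {c : ℝ} (hv : ∀ k, |v k| ≤ c) (m : ZMod d) :
    |∑ j : ZMod d, zmodSin (2 * (m * j)) * ∑ k, zmodSin (2 * (j * k)) * v k| ≤ 2 * d * c := by
  have hc : 0 ≤ c := (abs_nonneg _).trans (hv 0)
  have e1 : ∑ k : ZMod d, (if 2 * (m - k) = 0 then (1 : ℝ) else 0) ≤ 2 := by
    exact (Equiv.sum_comp (Equiv.subLeft m) fun k => if 2 * k = 0 then (1 : ℝ) else 0).trans_le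
      sum_ite_two_mul_eq_zero_le
  have e2 : ∑ k : ZMod d, (if 2 * (m + k) = 0 then (1 : ℝ) else 0) ≤ 2 := by
    exact (Equiv.sum_comp (Equiv.addLeft m) fun k => if 2 * k = 0 then (1 : ℝ) else 0).trans_le
      sum_ite_two_mul_eq_zero_le
  calc |∑ j : ZMod d, zmodSin (2 * (m * j)) * ∑ k, zmodSin (2 * (j * k)) * v k|
      = |∑ k, (∑ j : ZMod d, zmodSin (2 * (m * j)) * zmodSin (2 * (j * k))) * v k| := by
        simp_rw [Finset.mul_sum, Finset.sum_mul]
        rw [Finset.sum_comm]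
        simp_rw [mul_assoc]
    _ ≤ ∑ k, (d / 2 * ((if 2 * (m - k) = 0 then 1 else 0) +
          if 2 * (m + k) = 0 then 1 else 0)) * c := by
        refine (Finset.abs_sum_le_sum_abs _ _).trans (Finset.sum_le_sum fun k _ => ?_)
        rw [abs_mul]
        refine mul_le_mul (abs_sum_zmodSin_mul_zmodSin_le m k) (hv k) (abs_nonneg _) ?_
        exact (abs_nonneg _).trans (abs_sum_zmodSin_mul_zmodSin_le m k)
    _ = d / 2 * c * (∑ k : ZMod d, (if 2 * (m - k) = 0 then (1 : ℝ) else 0) +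
          ∑ k : ZMod d, (if 2 * (m + k) = 0 then (1 : ℝ) else 0)) := by
        rw [← Finset.sum_mul, ← Finset.mul_sum, Finset.sum_add_distrib]
        ring
    _ ≤ d / 2 * c * (2 + 2) := by gcongr
    _ = 2 * d * c := by ring

/-! ### Flattening diagonals by random orthogonal matrices. -/

/-- Signs such that finitely many quadratic forms, conjugated by the sign-twisted Hartley matrix,
have diagonals close to their means. -/
lemma exists_sign_offdiag_le {N : ℕ} (M : Fin N → Matrix (ZMod d) (ZMod d) ℝ)
    (hM : ∀ i, ∑ k, ∑ l, M i k l ^ 2 ≤ 1) {T : ℝ} (hT : 4 * (N * d) ≤ Real.exp (T / 16)) :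
    ∃ s : ZMod d → Bool, ∀ i j, |∑ k, ∑ l, if k = l then 0 else
      hartley d j k * hartley d j l * M i k l * (boolSign (s k) * boolSign (s l))| ≤ T / d := by
  have hd : (0 : ℝ) < d := Nat.cast_pos.2 (NeZero.pos d)
  set X : (ZMod d → Bool) → Fin N → ZMod d → ℝ := fun s i j => ∑ k, ∑ l, if k = l then 0 else
      hartley d j k * hartley d j l * M i k l * (boolSign (s k) * boolSign (s l)) with hX
  have mgf : ∀ c : ℝ, c ^ 2 = (d / 16 : ℝ) ^ 2 → ∀ i j,
      ∑ s, Real.exp (c * X s i j) ≤ 2 ^ d * 2 := by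
    intro c hc i j
    have := sum_exp_chaos_le (fun k l => c * (hartley d j k * hartley d j l * M i k l)) (by
      -- Here `(d/16)² (2/d)² = 1/64`, so the chaos hypothesis holds with `16/64 ≤ 3/4`.
      have h1 : ∀ k l, (c * (hartley d j k * hartley d j l * M i k l)) ^ 2
          ≤ (1 / 64) * M i k l ^ 2 := by
        intro k l
        calc (c * (hartley d j k * hartley d j l * M i k l)) ^ 2
            = c ^ 2 * (hartley d j k ^ 2 * hartley d j l ^ 2) * M i k l ^ 2 := by ring
          _ ≤ (d / 16 : ℝ) ^ 2 * (2 / d * (2 / d)) * M i k l ^ 2 := by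
              rw [hc]
              have := hartley_sq_le j k
              have := hartley_sq_le j l
              gcongr
          _ = (1 / 64) * M i k l ^ 2 := by field_simp; ring
      have h2 : ∑ k, ∑ l, (c * (hartley d j k * hartley d j l * M i k l)) ^ 2 ≤ 1 / 64 := by
        refine (Finset.sum_le_sum fun k _ => Finset.sum_le_sum fun l _ => h1 k l).trans ?_
        simp_rw [← Finset.mul_sum]
        linarith [hM i]
      linarith)
    rw [ZMod.card] at this
    refine le_of_eq_of_le (Finset.sum_congr rfl fun s _ => ?_) this
    congr 1
    simp only [hX, Finset.mul_sum, mul_ite, mul_zero, mul_assoc]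
  -- Union bound: some `s` does no worse than the average of the sum of all `2Nd` exponentials, each
  -- of mean at most `2`.
  obtain ⟨s, -, hs⟩ := Finset.exists_le_of_sum_le (s := (Finset.univ : Finset (ZMod d → Bool)))
    (f := fun s => ∑ i, ∑ j, (Real.exp (d / 16 * X s i j) + Real.exp (-(d / 16) * X s i j)))
    (g := fun _ => 4 * (N * d : ℝ)) Finset.univ_nonempty (by
      rw [Finset.sum_comm]
      calc _ ≤ ∑ i : Fin N, ∑ j : ZMod d, (2 ^ d * 2 + 2 ^ d * 2 : ℝ) := by
            refine Finset.sum_le_sum fun i _ => ?_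
            rw [Finset.sum_comm]
            refine Finset.sum_le_sum fun j _ => ?_
            rw [Finset.sum_add_distrib]
            exact add_le_add (mgf _ rfl i j) (mgf _ (by ring) i j)
        _ = _ := by
            simp [ZMod.card]
            ring)
  refine ⟨s, fun i j => ?_⟩
  change |X s i j| ≤ T / d
  have hle : Real.exp (d / 16 * X s i j) + Real.exp (-(d / 16) * X s i j)
      ≤ Real.exp (T / 16) := by
    refine le_trans ?_ (hs.trans hT)
    have hn : ∀ i j, 0 ≤ Real.exp (d / 16 * X s i j) + Real.exp (-(d / 16) * X s i j) :=
      fun i j => by positivity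
    refine le_trans ?_ (Finset.single_le_sum (f := fun i => ∑ j, (Real.exp (d / 16 * X s i j) +
      Real.exp (-(d / 16) * X s i j))) (fun i _ => Finset.sum_nonneg fun j _ => hn i j)
      (Finset.mem_univ i))
    exact Finset.single_le_sum (f := fun j => Real.exp (d / 16 * X s i j) +
      Real.exp (-(d / 16) * X s i j)) (fun j _ => hn i j) (Finset.mem_univ j)
  have h1 : d / 16 * X s i j ≤ T / 16 :=
    Real.exp_le_exp.1 (le_trans (le_add_of_nonneg_right (Real.exp_pos _).le) hle)
  have h2 : -(d / 16) * X s i j ≤ T / 16 :=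
    Real.exp_le_exp.1 (le_trans (le_add_of_nonneg_left (Real.exp_pos _).le) hle)
  rw [le_div_iff₀ hd, ← abs_of_pos hd, ← abs_mul, abs_le]
  constructor <;> linarith

/-- The subtracted term is the `k = l` part of the rotated form, where the signs square to `1`. -/
lemma exists_orthogonal_diag_sub_le {N : ℕ} (M : Fin N → Matrix (ZMod d) (ZMod d) ℝ)
    (hM : ∀ i, ∑ k, ∑ l, M i k l ^ 2 ≤ 1) {T : ℝ} (hT : 4 * (N * d) ≤ Real.exp (T / 16)) :
    ∃ Q : Matrix (ZMod d) (ZMod d) ℝ, Q * Q.transpose = 1 ∧ ∀ i j,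
      |(Q * M i * Q.transpose) j j - (∑ k, (1 + zmodSin (2 * (j * k))) * M i k k) / d|
        ≤ T / d := by
  obtain ⟨s, hs⟩ := exists_sign_offdiag_le M hM hT
  refine ⟨Matrix.of fun j k => hartley d j k * boolSign (s k), ?_, fun i j => ?_⟩
  · rw [← hartley_mul_transpose (d := d)]
    ext i j
    simp only [Matrix.mul_apply, Matrix.transpose_apply, Matrix.of_apply]
    refine Finset.sum_congr rfl fun k _ => ?_
    rw [mul_mul_mul_comm, boolSign_mul_self, mul_one]
  · refine le_of_eq_of_le ?_ (hs i j)
    congr 1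
    simp only [Matrix.mul_apply, Matrix.transpose_apply, Matrix.of_apply, Finset.sum_mul]
    rw [Finset.sum_comm, Finset.sum_div, ← Finset.sum_sub_distrib]
    refine Finset.sum_congr rfl fun k _ => ?_
    rw [sub_eq_iff_eq_add, ← Finset.add_sum_erase _ _ (Finset.mem_univ k), add_comm,
      ← Finset.add_sum_erase (a := k) (s := Finset.univ)
        (f := fun l => if k = l then (0 : ℝ) else _) (Finset.mem_univ k)]
    congr 1
    · rw [if_pos rfl, zero_add]
      refine Finset.sum_congr rfl fun l hl => ?_
      rw [if_neg (Finset.ne_of_mem_erase hl).symm]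
      ring
    · have := hartley_sq j k
      have h2 := boolSign_mul_self (s k)
      rw [mul_div_right_comm, ← this]
      linear_combination (hartley d j k ^ 2 * M i k k) * h2

lemma trace_conj {ι : Type*} [Fintype ι] [DecidableEq ι] {Q : Matrix ι ι ℝ}
    (hQ : Q * Q.transpose = 1) (M : Matrix ι ι ℝ) : (Q * M * Q.transpose).trace = M.trace := by
  rw [Matrix.trace_mul_comm, ← Matrix.mul_assoc, mul_eq_one_comm.1 hQ, Matrix.one_mul]

lemma sum_sq_eq_trace {ι : Type*} [Fintype ι] (M : Matrix ι ι ℝ) :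
    ∑ k, ∑ l, M k l ^ 2 = (M * M.transpose).trace := by
  simp [Matrix.trace, Matrix.mul_apply, sq]

lemma sum_sq_conj {ι : Type*} [Fintype ι] [DecidableEq ι] {Q : Matrix ι ι ℝ}
    (hQ : Q * Q.transpose = 1) (M : Matrix ι ι ℝ) :
    ∑ k, ∑ l, (Q * M * Q.transpose) k l ^ 2 = ∑ k, ∑ l, M k l ^ 2 := by
  rw [sum_sq_eq_trace, sum_sq_eq_trace, ← trace_conj hQ (M * M.transpose)]
  congr 1
  simp only [Matrix.transpose_mul, Matrix.transpose_transpose, Matrix.mul_assoc]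
  rw [← Matrix.mul_assoc Q.transpose Q, mul_eq_one_comm.1 hQ, Matrix.one_mul]

/-- One rotation turns the diagonal into its sine transform over `d`, up to `T/d`. After the second,
the main term is a double sine transform, contributing `2/d`. The first error contributes `T/d`
after transformation, and the second error adds `T/d`. -/
lemma exists_orthogonal_diag_le_of_unit {N : ℕ} (M : Fin N → Matrix (ZMod d) (ZMod d) ℝ)
    (hM : ∀ i, ∑ k, ∑ l, M i k l ^ 2 ≤ 1) (htr : ∀ i, (M i).trace = 0)
    {T : ℝ} (hT : 4 * (N * d) ≤ Real.exp (T / 16)) :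
    ∃ Q : Matrix (ZMod d) (ZMod d) ℝ, Q * Q.transpose = 1 ∧ ∀ i j,
      |(Q * M i * Q.transpose) j j| ≤ (2 + 2 * T) / d := by
  have hd : (0 : ℝ) < d := Nat.cast_pos.2 (NeZero.pos d)
  obtain ⟨Q, hQ, hQM⟩ := exists_orthogonal_diag_sub_le M hM hT
  obtain ⟨R, hR, hRM⟩ := exists_orthogonal_diag_sub_le (fun i => Q * M i * Q.transpose)
    (fun i => (sum_sq_conj hQ (M i)).trans_le (hM i)) hT
  have key : ∀ A : Matrix (ZMod d) (ZMod d) ℝ, A.trace = 0 → ∀ j,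
      ∑ k, (1 + zmodSin (2 * (j * k))) * A k k = ∑ k, zmodSin (2 * (j * k)) * A k k := by
    intro A hA j
    simp_rw [add_mul, Finset.sum_add_distrib, one_mul]
    rw [show ∑ k, A k k = 0 from hA, zero_add]
  refine ⟨R * Q, ?_, fun i j => ?_⟩
  · rw [Matrix.transpose_mul, Matrix.mul_assoc, ← Matrix.mul_assoc Q, hQ, Matrix.one_mul, hR]
  have e : R * Q * M i * (R * Q).transpose = R * (Q * M i * Q.transpose) * R.transpose := by
    simp only [Matrix.transpose_mul, Matrix.mul_assoc]
  rw [e]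
  have h2 := hRM i j
  rw [key _ ((trace_conj hQ _).trans (htr i))] at h2
  have h1 : ∀ k, |(Q * M i * Q.transpose) k k - (∑ l, zmodSin (2 * (k * l)) * M i l l) / d|
      ≤ T / d := fun k => by
    have := hQM i k
    rwa [key _ (htr i)] at this
  have hdiag : ∀ k, |M i k k| ≤ 1 := fun k => by
    rw [← sq_le_one_iff_abs_le_one]
    refine le_trans ?_ (hM i)
    refine le_trans ?_ (Finset.single_le_sum (f := fun k => ∑ l, M i k l ^ 2)
      (fun k _ => Finset.sum_nonneg fun l _ => sq_nonneg _) (Finset.mem_univ k))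
    exact Finset.single_le_sum (f := fun l => M i k l ^ 2) (fun l _ => sq_nonneg _)
      (Finset.mem_univ k)
  have h3 := abs_sum_sum_zmodSin_le hdiag j
  set v : ZMod d → ℝ := fun k => (Q * M i * Q.transpose) k k with hv
  set u : ZMod d → ℝ := fun k => ∑ l, zmodSin (2 * (k * l)) * M i l l with hu
  have h4 : |∑ k, zmodSin (2 * (j * k)) * (v k - u k / d)| ≤ T := by
    calc _ ≤ ∑ k : ZMod d, 1 * (T / d) := by
          refine (Finset.abs_sum_le_sum_abs _ _).trans (Finset.sum_le_sum fun k _ => ?_)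
          rw [abs_mul]
          exact mul_le_mul (abs_zmodSin_le_one _) (h1 k) (abs_nonneg _) zero_le_one
      _ = T := by
          simp [ZMod.card]
          field_simp
  have h5 : ∑ k, zmodSin (2 * (j * k)) * v k
      = ∑ k, zmodSin (2 * (j * k)) * (v k - u k / d) + (∑ k, zmodSin (2 * (j * k)) * u k) / d := by
    rw [Finset.sum_div, ← Finset.sum_add_distrib]
    exact Finset.sum_congr rfl fun k _ => by ring
  have h6 : |∑ k, zmodSin (2 * (j * k)) * v k| ≤ T + 2 := by
    rw [h5]
    refine (abs_add_le _ _).trans (add_le_add h4 ?_)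
    rw [abs_div, abs_of_pos hd, div_le_iff₀ hd]
    linarith
  have h7 : |(∑ k, zmodSin (2 * (j * k)) * v k) / d| ≤ (T + 2) / d := by
    rw [abs_div, abs_of_pos hd]
    gcongr
  have h8 := abs_add_le ((R * (Q * M i * Q.transpose) * R.transpose) j j -
    (∑ k, zmodSin (2 * (j * k)) * v k) / d) ((∑ k, zmodSin (2 * (j * k)) * v k) / d)
  rw [sub_add_cancel] at h8
  refine h8.trans ((add_le_add h2 h7).trans (le_of_eq ?_))
  ring

/-- Finitely many traceless matrices can be conjugated simultaneously by an orthogonal matrix so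
that all their diagonal entries are small compared with their Hilbert-Schmidt norms. -/
lemma exists_orthogonal_diag_le {N : ℕ} (M : Fin N → Matrix (ZMod d) (ZMod d) ℝ) (h : Fin N → ℝ)
    (hM : ∀ i, ∑ k, ∑ l, M i k l ^ 2 ≤ h i ^ 2) (hh : ∀ i, 0 ≤ h i) (htr : ∀ i, (M i).trace = 0)
    {T : ℝ} (hT : 4 * (N * d) ≤ Real.exp (T / 16)) :
    ∃ Q : Matrix (ZMod d) (ZMod d) ℝ, Q * Q.transpose = 1 ∧ ∀ i j,
      |(Q * M i * Q.transpose) j j| ≤ (2 + 2 * T) * h i / d := by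
  obtain ⟨Q, hQ, hQM⟩ := exists_orthogonal_diag_le_of_unit (fun i => (h i)⁻¹ • M i) (fun i => by
      simp only [Matrix.smul_apply, smul_eq_mul, mul_pow, ← Finset.mul_sum]
      calc (h i)⁻¹ ^ 2 * ∑ k, ∑ l, M i k l ^ 2 ≤ (h i)⁻¹ ^ 2 * h i ^ 2 := by
            gcongr
            exact hM i
        _ ≤ 1 := by
            rw [← mul_pow]
            exact pow_le_one₀ (mul_nonneg (inv_nonneg.2 (hh i)) (hh i)) inv_mul_le_one)
    (fun i => by rw [Matrix.trace_smul, htr, smul_zero]) hT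
  refine ⟨Q, hQ, fun i j => ?_⟩
  -- If `h i = 0`, the norm bound forces `M i = 0`, so the normalisation by `0⁻¹ = 0` loses nothing.
  have e : M i = h i • (h i)⁻¹ • M i := by
    rcases eq_or_ne (h i) 0 with h0 | h0
    · have h1 := hM i
      rw [h0] at h1 ⊢
      rw [zero_smul]
      ext k l
      have h2 : M i k l ^ 2 ≤ 0 := by
        refine le_trans ?_ (h1.trans (by norm_num))
        refine le_trans ?_ (Finset.single_le_sum (f := fun k => ∑ l, M i k l ^ 2)
          (fun k _ => Finset.sum_nonneg fun l _ => sq_nonneg _) (Finset.mem_univ k))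
        exact Finset.single_le_sum (f := fun l => M i k l ^ 2) (fun l _ => sq_nonneg _)
          (Finset.mem_univ l)
      simpa using le_antisymm h2 (sq_nonneg _)
    · rw [smul_smul, mul_inv_cancel₀ h0, one_smul]
  rw [e, Matrix.mul_smul, Matrix.smul_mul, Matrix.smul_apply, smul_eq_mul, abs_mul,
    abs_of_nonneg (hh i)]
  calc _ ≤ h i * ((2 + 2 * T) / d) := mul_le_mul_of_nonneg_left (hQM i j) (hh i)
    _ = _ := by ring

end Hartley

/-! ### Translation-invariant subspaces of `ℓ²(G)`. -/

/-- The left regular representation of `G` on complex functions, `(ρ x u)(g) = u (x⁻¹ g)`. -/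
def leftRegular (G : Type u) [Group G] : Representation ℂ G (G → ℂ) where
  toFun x := LinearMap.funLeft ℂ ℂ fun g => x⁻¹ * g
  map_one' := by ext; simp [LinearMap.funLeft]
  map_mul' x y := by
    refine LinearMap.ext fun v => funext fun g => ?_
    simp [LinearMap.funLeft, mul_assoc]

lemma leftRegular_apply {G : Type u} [Group G] (x : G) (v : G → ℂ) (g : G) :
    leftRegular G x v g = v (x⁻¹ * g) := rfl

/-- A nonzero subrepresentation of minimal dimension inside `σ` is irreducible. -/
lemma exists_irreducible_subrepresentation {k G V : Type*} [Field k] [Group G] [AddCommGroup V]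
    [Module k V] [FiniteDimensional k V] {ρ : Representation k G V} (σ : Subrepresentation ρ)
    (hσ : σ.toSubmodule ≠ ⊥) :
    ∃ τ : Subrepresentation ρ, τ.toSubmodule ≠ ⊥ ∧ τ.toSubmodule ≤ σ.toSubmodule ∧
      τ.toRepresentation.IsIrreducible := by
  classical
  have hex : ∃ m, ∃ τ : Subrepresentation ρ, τ.toSubmodule ≠ ⊥ ∧
      τ.toSubmodule ≤ σ.toSubmodule ∧ Module.finrank k τ.toSubmodule = m := ⟨_, σ, hσ, le_rfl, rfl⟩
  obtain ⟨τ, hτ, hle, hm⟩ := Nat.find_spec hex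
  refine ⟨τ, hτ, hle, ?_⟩
  have hne : (⊥ : Subrepresentation τ.toRepresentation) ≠ ⊤ := by
    intro h
    apply hτ
    have h2 := congrArg Subrepresentation.toSubmodule h
    rw [eq_bot_iff]
    intro v hv
    have : (⟨v, hv⟩ : τ.toSubmodule) ∈ (⊥ : Subrepresentation τ.toRepresentation).toSubmodule := by
      rw [h2]; trivial
    simpa using congrArg Subtype.val ((Submodule.mem_bot k).1 this)
  refine { exists_pair_ne := ⟨⊥, ⊤, hne⟩, eq_bot_or_eq_top := fun κ => ?_ }
  by_cases hκ : κ.toSubmodule = ⊥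
  · exact Or.inl (Subrepresentation.toSubmodule_injective hκ)
  · right
    let κ' : Subrepresentation ρ :=
      { toSubmodule := κ.toSubmodule.map τ.toSubmodule.subtype
        apply_mem_toSubmodule := by
          rintro g _ ⟨v, hv, rfl⟩
          exact ⟨τ.toRepresentation g v, κ.apply_mem_toSubmodule g hv, rfl⟩ }
    have h1 : κ'.toSubmodule ≤ τ.toSubmodule := Submodule.map_subtype_le _ _
    have h2 : κ'.toSubmodule ≠ ⊥ := fun h => hκ (eq_bot_iff.2 fun v hv => by
      have hmem : (v : V) ∈ κ'.toSubmodule := ⟨v, hv, rfl⟩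
      rw [h, Submodule.mem_bot] at hmem
      exact (Submodule.mem_bot k).2 (Subtype.ext hmem))
    have h3 : Module.finrank k τ.toSubmodule ≤ Module.finrank k κ'.toSubmodule := by
      rw [hm]
      exact Nat.find_min' hex ⟨κ', h2, h1.trans hle, rfl⟩
    have h4 := Submodule.eq_of_le_of_finrank_le h1 h3
    refine Subrepresentation.toSubmodule_injective (Submodule.eq_top_iff'.2 fun v => ?_)
    have : (v : V) ∈ κ'.toSubmodule := by
      rw [h4]
      exact v.2
    obtain ⟨w, hw, hwv⟩ := this
    rwa [← Subtype.ext hwv]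

section LeftInvariant

variable {G : Type u} [Group G] [Fintype G]

/-- Left translation on `ℓ²(G)`, as a linear isometry. -/
def leftTranslate (x : G) : EuclideanSpace ℝ G ≃ₗᵢ[ℝ] EuclideanSpace ℝ G :=
  LinearIsometryEquiv.piLpCongrLeft 2 ℝ ℝ (Equiv.mulLeft x)

lemma leftTranslate_apply (x : G) (v : EuclideanSpace ℝ G) (g : G) :
    leftTranslate x v g = v (x⁻¹ * g) := rfl

/-- The complexification of a real subspace of functions. -/
def complexify (W : Submodule ℝ (EuclideanSpace ℝ G)) : Submodule ℂ (G → ℂ) where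
  carrier := {v | WithLp.toLp 2 (fun g => (v g).re) ∈ W ∧ WithLp.toLp 2 (fun g => (v g).im) ∈ W}
  add_mem' := fun ha hb => ⟨W.add_mem ha.1 hb.1, W.add_mem ha.2 hb.2⟩
  zero_mem' := ⟨W.zero_mem, W.zero_mem⟩
  smul_mem' c v hv := by
    constructor
    · convert W.sub_mem (W.smul_mem c.re hv.1) (W.smul_mem c.im hv.2) using 1
      ext g; simp
    · convert W.add_mem (W.smul_mem c.re hv.2) (W.smul_mem c.im hv.1) using 1
      ext g; simp

lemma finrank_complexify_le (W : Submodule ℝ (EuclideanSpace ℝ G)) :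
    Module.finrank ℂ (complexify W) ≤ Module.finrank ℝ W := by
  let b := Module.finBasis ℝ W
  let c : Fin (Module.finrank ℝ W) → G → ℂ := fun k g => ((b k : EuclideanSpace ℝ G) g : ℂ)
  have hexp : ∀ (v : W) (g : G), (((v : EuclideanSpace ℝ G) g : ℝ) : ℂ)
      = ∑ k, (b.repr v k : ℂ) * c k g := by
    intro v g
    have := congrArg (fun w : W => (w : EuclideanSpace ℝ G) g) (b.sum_repr v)
    simp only [Submodule.coe_sum, Submodule.coe_smul, WithLp.ofLp_sum, WithLp.ofLp_smul,
      Finset.sum_apply, Pi.smul_apply, smul_eq_mul] at this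
    rw [← this]
    push_cast
    rfl
  have hle : complexify W ≤ Submodule.span ℂ (Set.range c) := by
    intro v hv
    have hv' : v = ∑ k, ((b.repr ⟨_, hv.1⟩ k : ℂ) + (b.repr ⟨_, hv.2⟩ k : ℂ) * Complex.I) • c k := by
      funext g
      have h1 := hexp ⟨_, hv.1⟩ g
      have h2 := hexp ⟨_, hv.2⟩ g
      simp only [Finset.sum_apply, Pi.smul_apply, smul_eq_mul]
      rw [← Complex.re_add_im (v g)]
      simp only at h1 h2
      rw [h1, h2, Finset.sum_mul, ← Finset.sum_add_distrib]
      exact Finset.sum_congr rfl fun k _ => by ring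
    rw [hv']
    exact Submodule.sum_mem _ fun k _ => Submodule.smul_mem _ _ (Submodule.subset_span ⟨k, rfl⟩)
  refine (Submodule.finrank_mono hle).trans ?_
  exact (finrank_range_le_card c).trans (by simp)

/-- An irreducible constituent of the complexification cannot be trivial: translation-fixed
functions are constant, and a constant of sum zero vanishes. -/
lemma minRepDim_le_finrank {W : Submodule ℝ (EuclideanSpace ℝ G)}
    (hW : ∀ x : G, ∀ v ∈ W, leftTranslate x v ∈ W) (hsum : ∀ v ∈ W, ∑ g, v g = 0) (hne : W ≠ ⊥) :
    minRepDim G ≤ Module.finrank ℝ W := by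
  let σ : Subrepresentation (leftRegular G) :=
    { toSubmodule := complexify W
      apply_mem_toSubmodule := fun g v hv => ⟨hW g _ hv.1, hW g _ hv.2⟩ }
  have hσ : σ.toSubmodule ≠ ⊥ := by
    obtain ⟨w, hw, hw0⟩ := Submodule.exists_mem_ne_zero_of_ne_bot hne
    refine fun h => hw0 ?_
    have hmem : (fun g => (w g : ℂ)) ∈ σ.toSubmodule :=
      ⟨hw, W.zero_mem⟩
    rw [h, Submodule.mem_bot] at hmem
    ext g
    simpa using congrFun hmem g
  obtain ⟨τ, hτ, hle, hirr⟩ := exists_irreducible_subrepresentation σ hσ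
  have hnt : ¬ τ.toRepresentation.IsTrivial := by
    intro ht
    apply hτ
    rw [eq_bot_iff]
    intro v hv
    have hconst : ∀ g, v g = v 1 := by
      intro g
      have h1 := congrArg Subtype.val (LinearMap.congr_fun (ht.out g) ⟨v, hv⟩)
      have h2 : leftRegular G g v = v := h1
      have h3 := congrFun h2 g
      rw [leftRegular_apply, inv_mul_cancel] at h3
      exact h3.symm
    obtain ⟨hre, him⟩ := hle hv
    have hcard : (Fintype.card G : ℝ) ≠ 0 := Nat.cast_ne_zero.2 Fintype.card_ne_zero
    have h1 := hsum _ hre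
    have h2 := hsum _ him
    simp only [hconst, Finset.sum_const, Finset.card_univ, nsmul_eq_mul, mul_eq_zero, hcard,
      false_or] at h1 h2
    rw [Submodule.mem_bot]
    funext g
    rw [hconst]
    exact Complex.ext h1 h2
  have hmem : Module.finrank ℂ τ.toSubmodule ∈ nontrivialIrrepDims G :=
    ⟨τ.toSubmodule, inferInstance, inferInstance, τ.toRepresentation, inferInstance, hirr, hnt, rfl⟩
  exact (Nat.sInf_le hmem).trans ((Submodule.finrank_mono hle).trans (finrank_complexify_le W))

/-- The sum is `‖P δ_g‖²` for the projection `P` onto `W`. As `P` commutes with translations, this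
does not depend on `g`, and its total over `G` is `dim W`. -/
lemma sum_sq_orthonormalBasis_eq {W : Submodule ℝ (EuclideanSpace ℝ G)}
    (hW : ∀ x : G, ∀ v ∈ W, leftTranslate x v ∈ W) {ι : Type*} [Fintype ι]
    (b : OrthonormalBasis ι ℝ W) (g : G) :
    ∑ k, (b k : EuclideanSpace ℝ G) g ^ 2 = (Fintype.card ι : ℝ) / Fintype.card G := by
  classical
  have hmap : ∀ x : G, W.map (leftTranslate x).toLinearEquiv.toLinearMap = W := by
    intro x
    refine le_antisymm (Submodule.map_le_iff_le_comap.2 (hW x)) fun v hv => ?_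
    refine ⟨leftTranslate x⁻¹ v, hW _ _ hv, ?_⟩
    ext h
    change leftTranslate x (leftTranslate x⁻¹ v) h = v h
    simp [leftTranslate_apply]
  have hp : ∀ h : G, ∑ k, (b k : EuclideanSpace ℝ G) h ^ 2
      = ‖W.starProjection (EuclideanSpace.single h 1)‖ ^ 2 := by
    intro h
    have := b.sum_sq_norm_inner_left (W.orthogonalProjectionOnto (EuclideanSpace.single h 1))
    rw [Submodule.starProjection_apply, ← Submodule.coe_norm, ← this]
    refine Finset.sum_congr rfl fun k _ => ?_
    rw [Submodule.inner_orthogonalProjectionOnto_eq_of_mem_right,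
      EuclideanSpace.inner_single_left]
    simp
  have htr : ∀ h : G, ∑ k, (b k : EuclideanSpace ℝ G) h ^ 2
      = ∑ k, (b k : EuclideanSpace ℝ G) 1 ^ 2 := by
    intro h
    rw [hp, hp]
    have h1 := Submodule.starProjection_map_apply (leftTranslate h) W (EuclideanSpace.single h 1)
    have h2 : (leftTranslate h).symm (EuclideanSpace.single h (1 : ℝ))
        = EuclideanSpace.single 1 1 := by
      rw [LinearIsometryEquiv.symm_apply_eq]
      ext g
      simp [leftTranslate_apply, inv_mul_eq_one, eq_comm]
    simp only [hmap, h2] at h1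
    rw [h1, LinearIsometryEquiv.norm_map]
  have hsum : ∑ h : G, ∑ k, (b k : EuclideanSpace ℝ G) h ^ 2 = Fintype.card ι := by
    rw [Finset.sum_comm]
    have : ∀ k, ∑ h : G, (b k : EuclideanSpace ℝ G) h ^ 2 = 1 := by
      intro k
      rw [← EuclideanSpace.real_norm_sq_eq, Submodule.norm_coe, b.norm_eq_one, one_pow]
    simp [this]
  have hcard : (Fintype.card G : ℝ) ≠ 0 := Nat.cast_ne_zero.2 Fintype.card_ne_zero
  rw [eq_div_iff hcard, htr, ← hsum, Finset.sum_congr rfl fun h _ => htr h]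
  simp [mul_comm]

end LeftInvariant

/-! ### Equidistributed bases of a single subspace. -/

lemma sum_sq_sub_mean_le {V : Type*} [Fintype V] (f : V → ℝ) :
    ∑ g, (f g - (∑ h, f h) / Fintype.card V) ^ 2 ≤ ∑ g, f g ^ 2 := by
  rcases isEmpty_or_nonempty V with h | h
  · simp
  have hn : (0 : ℝ) < Fintype.card V := Nat.cast_pos.2 Fintype.card_pos
  set S := ∑ h, f h with hS
  have e : ∑ g, (f g - S / Fintype.card V) ^ 2 = ∑ g, f g ^ 2 - S ^ 2 / Fintype.card V := by
    simp_rw [sub_sq, Finset.sum_add_distrib, Finset.sum_sub_distrib, ← Finset.sum_mul,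
      ← Finset.mul_sum, ← hS]
    simp only [Finset.sum_const, Finset.card_univ, nsmul_eq_mul]
    field_simp
    ring
  rw [e]
  have : 0 ≤ S ^ 2 / Fintype.card V := by positivity
  linarith

lemma conj_diagonal_apply {ι V : Type*} [Fintype V] [DecidableEq V] (A : Matrix ι V ℝ)
    (f : V → ℝ) (j k : ι) :
    (A * Matrix.diagonal f * A.transpose) j k = ∑ g, f g * (A j g * A k g) := by
  rw [Matrix.mul_apply]
  refine Finset.sum_congr rfl fun g _ => ?_
  rw [Matrix.mul_diagonal, Matrix.transpose_apply]
  ring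

/-- A subspace of functions whose orthogonal projection has constant diagonal has an orthonormal
basis of functions whose squares are equidistributed against finitely many test functions. -/
lemma exists_equidistributed_orthonormalBasis {V : Type*} [Fintype V] {d : ℕ} [NeZero d]
    {W : Submodule ℝ (EuclideanSpace ℝ V)} (b : OrthonormalBasis (ZMod d) ℝ W)
    (hb : ∀ g, ∑ k, (b k : EuclideanSpace ℝ V) g ^ 2 = (d : ℝ) / Fintype.card V)
    {N : ℕ} (f : Fin N → V → ℝ) {T : ℝ} (hT : 4 * (N * d) ≤ Real.exp (T / 16)) :
    ∃ c : OrthonormalBasis (ZMod d) ℝ W, ∀ j i,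
      |∑ g, (c j : EuclideanSpace ℝ V) g ^ 2 * f i g - (∑ g, f i g) / Fintype.card V|
        ≤ (2 + 2 * T) * (l2Norm (f i) * Real.sqrt (d / Fintype.card V)) / d := by
  classical
  set m : Fin N → ℝ := fun i => (∑ g, f i g) / Fintype.card V with hm
  set B : ZMod d → V → ℝ := fun k g => (b k : EuclideanSpace ℝ V) g with hB
  set M : Fin N → Matrix (ZMod d) (ZMod d) ℝ := fun i => Matrix.of fun k l =>
    ∑ g, (f i g - m i) * (B k g * B l g) with hM
  have horth : Orthonormal ℝ fun k => (b k : EuclideanSpace ℝ V) :=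
    b.orthonormal.comp_linearIsometry W.subtypeₗᵢ
  have hcard : ∀ i, ∑ g, (f i g - m i) = 0 := fun i => by
    rcases isEmpty_or_nonempty V with h | h
    · simp
    have hn : (Fintype.card V : ℝ) ≠ 0 := Nat.cast_ne_zero.2 Fintype.card_ne_zero
    rw [Finset.sum_sub_distrib]
    simp [hm, mul_div_cancel₀ _ hn]
  have hHS : ∀ i, ∑ k, ∑ l, M i k l ^ 2 ≤ (l2Norm (f i) * Real.sqrt (d / Fintype.card V)) ^ 2 := by
    intro i
    -- Row `k` lists the coefficients of `(f - mean) b_k` along the `b_l`, so Bessel applies;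
    -- summing over `k` then uses the constant diagonal.
    have bessel : ∀ k, ∑ l, M i k l ^ 2 ≤ ∑ g, (f i g - m i) ^ 2 * B k g ^ 2 := by
      intro k
      have h := horth.sum_inner_products_le (WithLp.toLp 2 fun g => (f i g - m i) * B k g)
        (s := Finset.univ)
      rw [EuclideanSpace.real_norm_sq_eq] at h
      refine le_trans (le_of_eq ?_) (h.trans (le_of_eq ?_))
      · refine Finset.sum_congr rfl fun l _ => ?_
        rw [Real.norm_eq_abs, sq_abs, PiLp.inner_apply]
        congr 1
        refine Finset.sum_congr rfl fun g _ => ?_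
        simp [hB, mul_assoc]
      · exact Finset.sum_congr rfl fun g _ => mul_pow _ _ _
    refine (Finset.sum_le_sum fun k _ => bessel k).trans ?_
    rw [Finset.sum_comm]
    simp_rw [← Finset.mul_sum]
    have hb' : ∀ g, ∑ k, B k g ^ 2 = (d : ℝ) / Fintype.card V := hb
    simp_rw [hb', ← Finset.sum_mul]
    rw [mul_pow, Real.sq_sqrt (by positivity), l2Norm,
      Real.sq_sqrt (Finset.sum_nonneg fun _ _ => sq_nonneg _)]
    exact mul_le_mul_of_nonneg_right (sum_sq_sub_mean_le (f i)) (by positivity)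
  have htr : ∀ i, (M i).trace = 0 := by
    intro i
    simp only [Matrix.trace, Matrix.diag_apply, hM, Matrix.of_apply]
    rw [Finset.sum_comm]
    have hb' : ∀ g, ∑ k, (f i g - m i) * (B k g * B k g)
        = (f i g - m i) * ((d : ℝ) / Fintype.card V) := fun g => by
      rw [← Finset.mul_sum, ← hb g]
      simp only [hB, sq]
    rw [Finset.sum_congr rfl fun g _ => hb' g, ← Finset.sum_mul, hcard, zero_mul]
  obtain ⟨Q, hQ, hQM⟩ := exists_orthogonal_diag_le M _ hHS
    (fun i => mul_nonneg (Real.sqrt_nonneg _) (Real.sqrt_nonneg _)) htr hT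
  let c : ZMod d → W := fun j => b.repr.symm (WithLp.toLp 2 fun k => Q j k)
  have hc : Orthonormal ℝ c := by
    rw [orthonormal_iff_ite]
    intro i j
    rw [LinearIsometryEquiv.inner_map_map, EuclideanSpace.inner_toLp_toLp]
    have := congrFun (congrFun hQ i) j
    rw [Matrix.one_apply] at this
    rw [← this]
    simp [Matrix.mul_apply, dotProduct, mul_comm]
  have hcd : Fintype.card (ZMod d) = Module.finrank ℝ W :=
    (Module.finrank_eq_card_basis b.toBasis).symm
  let C := (basisOfOrthonormalOfCardEqFinrank hc hcd).toOrthonormalBasis (by simpa using hc)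
  have hC : ∀ j, C j = c j := fun j => by simp [C]
  have hval : ∀ j g, (C j : EuclideanSpace ℝ V) g = ∑ k, Q j k * B k g := by
    intro j g
    have h : c j = ∑ k, Q j k • b k := (b.sum_repr_symm _).symm
    rw [hC, h]
    simp [hB]
  refine ⟨C, fun j i => ?_⟩
  have hnorm : ∑ g, (C j : EuclideanSpace ℝ V) g ^ 2 = 1 := by
    rw [← EuclideanSpace.real_norm_sq_eq, Submodule.norm_coe, C.norm_eq_one, one_pow]
  have hquad : (Q * M i * Q.transpose) j j
      = ∑ g, (f i g - m i) * (C j : EuclideanSpace ℝ V) g ^ 2 := by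
    have hM' : M i = Matrix.of B * Matrix.diagonal (fun g => f i g - m i) *
        (Matrix.of B).transpose := by
      ext k l
      rw [conj_diagonal_apply]
      rfl
    have hassoc : Q * M i * Q.transpose = Q * Matrix.of B *
        Matrix.diagonal (fun g => f i g - m i) * (Q * Matrix.of B).transpose := by
      rw [hM']
      simp only [Matrix.transpose_mul, Matrix.mul_assoc]
    rw [hassoc, conj_diagonal_apply]
    refine Finset.sum_congr rfl fun g _ => ?_
    rw [hval, sq]
    rfl
  have := hQM i j
  rw [hquad] at this
  refine le_of_eq_of_le ?_ this
  congr 1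
  simp_rw [sub_mul, Finset.sum_sub_distrib, ← Finset.mul_sum, hnorm, mul_one]
  simp [mul_comm, hm]

/-! ### Joint eigenspaces of the adjacency and all-ones operators. -/

section AdjacencyMatrix

variable {G : Type u} [Group G]

open Classical in
/-- The real adjacency matrix of `Cay(G, S)`. -/
def adjacencyMatrix (S : Set G) : Matrix G G ℝ :=
  Matrix.of fun x y => if (cayleyGraph S).Adj x y then 1 else 0

/-- The matrix all of whose entries are `1`. -/
def allOnes (V : Type*) : Matrix V V ℝ := Matrix.of fun _ _ => 1

lemma cayleyGraph_adj (S : Set G) (x y : G) : (cayleyGraph S).Adj x y ↔ x⁻¹ * y ∈ S := by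
  constructor
  · rintro ⟨s, hs, rfl⟩
    simpa using hs
  · exact fun h => ⟨_, h, by simp⟩

lemma adjacencyMatrix_mul_left (S : Set G) (x g h : G) :
    adjacencyMatrix S (x * g) (x * h) = adjacencyMatrix S g h := by
  classical
  simp only [adjacencyMatrix, Matrix.of_apply, cayleyGraph_adj]
  rw [show (x * g)⁻¹ * (x * h) = g⁻¹ * h by group]

lemma adjacencyMatrix_symm {S : Set G} (hS : ∀ s ∈ S, s⁻¹ ∈ S) (x y : G) :
    adjacencyMatrix S x y = adjacencyMatrix S y x := by
  classical
  have : x⁻¹ * y ∈ S ↔ y⁻¹ * x ∈ S :=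
    ⟨fun h => by simpa using hS _ h, fun h => by simpa using hS _ h⟩
  simp only [adjacencyMatrix, Matrix.of_apply, cayleyGraph_adj, this]

variable [Fintype G]

/-- The two products record row and column sums, all equal because the graph is regular and
symmetric. -/
lemma adjacencyMatrix_commute_allOnes {S : Set G} (hS : ∀ s ∈ S, s⁻¹ ∈ S) :
    adjacencyMatrix S * allOnes G = allOnes G * adjacencyMatrix S := by
  have hrow : ∀ x, ∑ y, adjacencyMatrix S x y = ∑ y, adjacencyMatrix S 1 y := by
    intro x
    rw [← Equiv.sum_comp (Equiv.mulLeft x)]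
    refine Finset.sum_congr rfl fun y _ => ?_
    have := adjacencyMatrix_mul_left S x 1 y
    rwa [mul_one] at this
  ext x y
  simp only [Matrix.mul_apply, allOnes, Matrix.of_apply, mul_one, one_mul]
  rw [hrow, ← hrow y]
  exact Finset.sum_congr rfl fun z _ => adjacencyMatrix_symm hS _ _

lemma toEuclideanLin_isSymmetric {V : Type*} [Fintype V] [DecidableEq V] {A : Matrix V V ℝ}
    (hA : ∀ x y, A x y = A y x) : (Matrix.toEuclideanLin A).IsSymmetric := by
  rw [Matrix.isSymmetric_toEuclideanLin_iff]
  ext x y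
  simpa using hA y x

lemma toEuclideanLin_real_apply {V : Type*} [Fintype V] [DecidableEq V] (A : Matrix V V ℝ)
    (v : EuclideanSpace ℝ V) (x : V) : Matrix.toEuclideanLin A v x = ∑ y, A x y * v y := rfl

/-- The joint eigenspaces of the adjacency operator and the all-ones operator. -/
def jointEigenspace [DecidableEq G] (S : Set G) (i : ℝ × ℝ) :
    Submodule ℝ (EuclideanSpace ℝ G) :=
  Module.End.eigenspace (Matrix.toEuclideanLin (adjacencyMatrix S)) i.2 ⊓
    Module.End.eigenspace (Matrix.toEuclideanLin (allOnes G)) i.1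

variable [DecidableEq G]

lemma mem_jointEigenspace {S : Set G} {i : ℝ × ℝ} {v : EuclideanSpace ℝ G} :
    v ∈ jointEigenspace S i ↔ (∀ x, ∑ y, adjacencyMatrix S x y * v y = i.2 * v x) ∧
      ∀ x, ∑ y, v y = i.1 * v x := by
  rw [jointEigenspace, Submodule.mem_inf, Module.End.mem_eigenspace_iff,
    Module.End.mem_eigenspace_iff]
  refine and_congr ⟨fun h x => ?_, fun h => ?_⟩ ⟨fun h x => ?_, fun h => ?_⟩
  · exact congrArg (fun w : EuclideanSpace ℝ G => w x) h
  · ext x; exact h x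
  · have := congrArg (fun w : EuclideanSpace ℝ G => w x) h
    simpa [toEuclideanLin_real_apply, allOnes] using this
  · ext x
    simpa [toEuclideanLin_real_apply, allOnes] using h x

lemma leftTranslate_mem_jointEigenspace {S : Set G} {i : ℝ × ℝ} (x : G)
    (v : EuclideanSpace ℝ G) (hv : v ∈ jointEigenspace S i) :
    leftTranslate x v ∈ jointEigenspace S i := by
  rw [mem_jointEigenspace] at hv ⊢
  simp only [leftTranslate_apply]
  refine ⟨fun g => ?_, fun g => ?_⟩
  · rw [← hv.1, ← Equiv.sum_comp (Equiv.mulLeft x)]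
    refine Finset.sum_congr rfl fun y _ => ?_
    have := adjacencyMatrix_mul_left S x (x⁻¹ * g) y
    rw [mul_inv_cancel_left] at this
    rw [Equiv.coe_mulLeft, this, inv_mul_cancel_left]
  · rw [← hv.2, ← Equiv.sum_comp (Equiv.mulLeft x)]
    simp

lemma sum_sq_mul_eq_mean_of_const {V : Type*} [Fintype V] {v : EuclideanSpace ℝ V} {c : ℝ}
    (hv : ∀ g, v g = c) (hnorm : ‖v‖ = 1) (f : V → ℝ) :
    ∑ g, v g ^ 2 * f g = (∑ g, f g) / Fintype.card V := by
  have h := EuclideanSpace.real_norm_sq_eq v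
  simp only [hnorm, hv, Finset.sum_const, Finset.card_univ, nsmul_eq_mul, one_pow] at h
  simp only [hv, ← Finset.mul_sum]
  have hn : (Fintype.card V : ℝ) ≠ 0 := by
    intro h0
    rw [h0, zero_mul] at h
    exact one_ne_zero h
  rw [eq_div_iff hn]
  linear_combination -(∑ g, f g) * h

/-- With `T = 16L` and `1 ≤ 16L`, one has `2 + 2T ≤ 64L`; the factor `√r / d` is `1 / √(d n)`, and
`d ≥ D`. -/
lemma two_add_mul_div_le {D d n L r F : ℝ} (hD : 0 < D) (hDd : D ≤ d) (hn : 0 < n)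
    (hL : 1 ≤ 16 * L) (hr : r = d / n) (hF : 0 ≤ F) :
    (2 + 2 * (16 * L)) * (F * Real.sqrt r) / d ≤ 64 * (L / Real.sqrt D) * (F / Real.sqrt n) := by
  have hd : 0 < d := hD.trans_le hDd
  have hsd : 0 < Real.sqrt d := Real.sqrt_pos.2 hd
  have hsD : 0 < Real.sqrt D := Real.sqrt_pos.2 hD
  have hsn : 0 < Real.sqrt n := Real.sqrt_pos.2 hn
  have e : Real.sqrt r / d = 1 / (Real.sqrt d * Real.sqrt n) := by
    rw [hr, Real.sqrt_div hd.le]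
    nth_rewrite 2 [← Real.mul_self_sqrt hd.le]
    field_simp
  calc (2 + 2 * (16 * L)) * (F * Real.sqrt r) / d
      = (2 + 2 * (16 * L)) * F * (Real.sqrt r / d) := by ring
    _ = (2 + 2 * (16 * L)) * F * (1 / (Real.sqrt d * Real.sqrt n)) := by rw [e]
    _ ≤ 64 * L * F * (1 / (Real.sqrt D * Real.sqrt n)) := by
        have := Real.sqrt_le_sqrt hDd
        have hL0 : 0 ≤ L := by linarith
        gcongr
        linarith
    _ = 64 * (L / Real.sqrt D) * (F / Real.sqrt n) := by field_simp

lemma exists_equidistributed_basis_jointEigenspace {S : Set G} {ε : ℝ} (hε : 0 < ε)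
    (hD : Real.log (Fintype.card G) ^ 2 ≤ (minRepDim G : ℝ)) {M : ℕ}
    (hM : (M : ℝ) ≤ (1 / 24 : ℝ) * (Fintype.card G : ℝ) ^ ε) (f : Fin M → G → ℝ) (i : ℝ × ℝ) :
    ∃ b : OrthonormalBasis (Fin (Module.finrank ℝ (jointEigenspace S i))) ℝ (jointEigenspace S i),
      ∀ k j, |∑ g, (b k : EuclideanSpace ℝ G) g ^ 2 * f j g - (∑ g, f j g) / Fintype.card G|
        ≤ 64 * ((ε + 1) * Real.log (Fintype.card G) / Real.sqrt (minRepDim G)) *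
            (l2Norm (f j) / Real.sqrt (Fintype.card G)) := by
  have hn : 1 ≤ Fintype.card G := Fintype.card_pos
  have hn' : (0 : ℝ) < Fintype.card G := Nat.cast_pos.2 hn
  have hlog : 0 ≤ Real.log (Fintype.card G) := Real.log_natCast_nonneg _
  have hconst : (∀ v ∈ jointEigenspace S i, ∃ c, ∀ g, v g = c) →
      ∃ b : OrthonormalBasis (Fin (Module.finrank ℝ (jointEigenspace S i))) ℝ
        (jointEigenspace S i), ∀ k j,
        |∑ g, (b k : EuclideanSpace ℝ G) g ^ 2 * f j g - (∑ g, f j g) / Fintype.card G|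
        ≤ 64 * ((ε + 1) * Real.log (Fintype.card G) / Real.sqrt (minRepDim G)) *
            (l2Norm (f j) / Real.sqrt (Fintype.card G)) := by
    intro hc
    refine ⟨stdOrthonormalBasis ℝ _, fun k j => ?_⟩
    obtain ⟨c, hc⟩ := hc _ (stdOrthonormalBasis ℝ (jointEigenspace S i) k).2
    rw [sum_sq_mul_eq_mean_of_const hc (by
      rw [Submodule.norm_coe, OrthonormalBasis.norm_eq_one]), sub_self, abs_zero]
    have : 0 ≤ l2Norm (f j) := Real.sqrt_nonneg _
    positivity
  by_cases hi : i.1 = 0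
  swap
  · refine hconst fun v hv => ⟨(∑ y, v y) / i.1, fun g => ?_⟩
    rw [(mem_jointEigenspace.1 hv).2 g, mul_div_cancel_left₀ _ hi]
  rcases hn.eq_or_lt with h1 | h2
  · have : Subsingleton G := Fintype.card_le_one_iff_subsingleton.1 h1.ge
    exact hconst fun v _ => ⟨v 1, fun g => by rw [Subsingleton.elim g 1]⟩
  set W := jointEigenspace S i with hW
  -- The zero eigenspace is set aside because `ZMod 0` is infinite and cannot index its basis.
  rcases eq_or_ne (Module.finrank ℝ W) 0 with h0 | h0
  · refine ⟨stdOrthonormalBasis ℝ _, fun k => ?_⟩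
    exact absurd (k.2.trans_eq h0) (Nat.not_lt_zero _)
  have : NeZero (Module.finrank ℝ W) := ⟨h0⟩
  have hne : W ≠ ⊥ := by
    intro h
    rw [h, finrank_bot] at h0
    exact h0 rfl
  have hinv : ∀ x : G, ∀ v ∈ W, leftTranslate x v ∈ W :=
    fun x v hv => leftTranslate_mem_jointEigenspace x v hv
  have hdim := minRepDim_le_finrank hinv (fun v hv => by
    rw [(mem_jointEigenspace.1 hv).2 1, hi, zero_mul]) hne
  let e : Fin (Module.finrank ℝ W) ≃ ZMod (Module.finrank ℝ W) :=
    Fintype.equivOfCardEq (by rw [Fintype.card_fin, ZMod.card])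
  have hlog2 : Real.log 2 ≤ Real.log (Fintype.card G) :=
    Real.log_le_log two_pos (by exact_mod_cast h2)
  have hlog3 := Real.log_two_gt_d9
  have hDpos : (0 : ℝ) < minRepDim G := lt_of_lt_of_le (pow_pos (by linarith) 2) hD
  have hdn : (Module.finrank ℝ W : ℝ) ≤ Fintype.card G := by
    exact_mod_cast (Submodule.finrank_le W).trans_eq (finrank_euclideanSpace)
  obtain ⟨c, hc⟩ := exists_equidistributed_orthonormalBasis
    ((stdOrthonormalBasis ℝ W).reindex e) (fun g => by
      rw [sum_sq_orthonormalBasis_eq hinv, ZMod.card]) f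
    -- This makes `exp (T/16) = |G|^(ε+1)`, which dominates `4 M d` since `d ≤ |G|`.
    (T := 16 * ((ε + 1) * Real.log (Fintype.card G))) (by
      rw [mul_div_cancel_left₀ _ (by norm_num : (16 : ℝ) ≠ 0), mul_comm (ε + 1),
        ← Real.rpow_def_of_pos hn', Real.rpow_add hn', Real.rpow_one]
      have h24 : (0 : ℝ) ≤ (Fintype.card G : ℝ) ^ ε := by positivity
      calc 4 * ((M : ℝ) * Module.finrank ℝ W)
          ≤ 4 * ((1 / 24 : ℝ) * (Fintype.card G : ℝ) ^ ε * Fintype.card G) := by gcongr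
        _ ≤ _ := by nlinarith [mul_nonneg h24 hn'.le])
  refine ⟨c.reindex e.symm, fun k j => ?_⟩
  rw [OrthonormalBasis.reindex_apply]
  refine (hc _ j).trans (two_add_mul_div_le hDpos (by exact_mod_cast hdim) hn' ?_ rfl
    (Real.sqrt_nonneg _))
  nlinarith

end AdjacencyMatrix

/-! ### Assembling the eigenspaces and passing to complex scalars. -/

theorem exists_real_eigenbasis {G : Type u} [Group G] [Fintype G] {ε : ℝ} (hε : 0 < ε)
    (hD : Real.log (Fintype.card G) ^ 2 ≤ (minRepDim G : ℝ))
    {S : Set G} (hS : ∀ s ∈ S, s⁻¹ ∈ S) {M : ℕ}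
    (hM : (M : ℝ) ≤ (1 / 24 : ℝ) * (Fintype.card G : ℝ) ^ ε) (f : Fin M → G → ℝ) :
    ∃ b : OrthonormalBasis (Fin (Fintype.card G)) ℝ (EuclideanSpace ℝ G), ∀ k,
      (∃ μ : ℝ, ∀ x, ∑ y, adjacencyMatrix S x y * b k y = μ * b k x) ∧
      ∀ j, |∑ g, b k g ^ 2 * f j g - (∑ g, f j g) / Fintype.card G|
        ≤ 64 * ((ε + 1) * Real.log (Fintype.card G) / Real.sqrt (minRepDim G)) *
            (l2Norm (f j) / Real.sqrt (Fintype.card G)) := by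
  classical
  choose b hb using exists_equidistributed_basis_jointEigenspace (S := S) hε hD hM f
  have hA := toEuclideanLin_isSymmetric (adjacencyMatrix_symm hS)
  have hJ : (Matrix.toEuclideanLin (allOnes G)).IsSymmetric :=
    toEuclideanLin_isSymmetric fun _ _ => rfl
  have hcomm : Commute (Matrix.toEuclideanLin (adjacencyMatrix S))
      (Matrix.toEuclideanLin (allOnes G)) := by
    refine LinearMap.ext fun v => ?_
    have h := congrArg (fun A => Matrix.toEuclideanLin A v) (adjacencyMatrix_commute_allOnes hS)
    simpa [Matrix.toLpLin_apply] using h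
  -- Commuting symmetric operators are jointly diagonalisable, so the bases of the joint eigenspaces
  -- glue to one of the whole space.
  have hint : DirectSum.IsInternal (jointEigenspace S) :=
    LinearMap.IsSymmetric.directSum_isInternal_of_commute hA hJ hcomm
  have horth : OrthogonalFamily ℝ (fun i => jointEigenspace S i)
      fun i => (jointEigenspace S i).subtypeₗᵢ :=
    LinearMap.IsSymmetric.orthogonalFamily_eigenspace_inf_eigenspace hA hJ
  let c := hint.collectedBasis fun i => (b i).toBasis
  have hc : Orthonormal ℝ c :=
    DirectSum.IsInternal.collectedBasis_orthonormal horth hint fun i => by simp [(b i).orthonormal]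
  have : Fintype (Σ i : ℝ × ℝ, Fin (Module.finrank ℝ (jointEigenspace S i))) :=
    FiniteDimensional.fintypeBasisIndex c
  let e : (Σ i : ℝ × ℝ, Fin (Module.finrank ℝ (jointEigenspace S i))) ≃ Fin (Fintype.card G) :=
    Fintype.equivFinOfCardEq (by
      rw [← Module.finrank_eq_card_basis c, finrank_euclideanSpace])
  refine ⟨(c.toOrthonormalBasis hc).reindex e, fun k => ?_⟩
  have hk : (c.toOrthonormalBasis hc).reindex e k
      = (b (e.symm k).1 (e.symm k).2 : EuclideanSpace ℝ G) := by
    simp [c]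
  rw [hk]
  exact ⟨⟨_, (mem_jointEigenspace.1 (b (e.symm k).1 (e.symm k).2).2).1⟩, hb _ _⟩

end CayleyQUE

end

theorem corollary1p3 {G : Type*} [Group G] [Fintype G]
    (ε : ℝ) (hε : 0 < ε)
    (hD : Real.log (Fintype.card G) ^ 2 ≤ (CayleyQUE.minRepDim G : ℝ))
    (S : Set G) (hS : ∀ s ∈ S, s⁻¹ ∈ S)
    (M : ℕ)
    (hM : (M : ℝ) ≤ min ((1 / 24 : ℝ) * (Fintype.card G : ℝ) ^ ε)
      ((1 / 8 : ℝ) * (Fintype.card G : ℝ)⁻¹ * Real.exp ((CayleyQUE.minRepDim G : ℝ) / 12)))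
    (f : Fin M → G → ℝ) :
    ∃ B : OrthonormalBasis (Fin (Fintype.card G)) ℂ (EuclideanSpace ℂ G),
      CayleyQUE.IsRealEigenbasis
        (CayleyQUE.adjacencyOperator (CayleyQUE.cayleyGraph S)) B ∧
      ∀ (b : Fin (Fintype.card G)) (i : Fin M),
        |CayleyQUE.quantumMean (B b) (f i) - (∑ g : G, f i g) / (Fintype.card G : ℝ)|
          ≤ 64 * ((ε + 1) * Real.log (Fintype.card G) / Real.sqrt (CayleyQUE.minRepDim G)) *
            (CayleyQUE.l2Norm (f i) / Real.sqrt (Fintype.card G)) := by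
  classical
  obtain ⟨b, hb⟩ := CayleyQUE.exists_real_eigenbasis hε hD hS (hM.trans (min_le_left _ _)) f
  let c : Fin (Fintype.card G) → EuclideanSpace ℂ G := fun k =>
    WithLp.toLp 2 fun g => (b k g : ℂ)
  have hc : Orthonormal ℂ c := by
    rw [orthonormal_iff_ite]
    intro i j
    have h := orthonormal_iff_ite.1 b.orthonormal i j
    rw [PiLp.inner_apply] at h ⊢
    have h2 := congrArg (fun r : ℝ => (r : ℂ)) h
    simpa [c, apply_ite] using h2
  have : Nonempty (Fin (Fintype.card G)) := ⟨⟨0, Fintype.card_pos⟩⟩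
  let C := (basisOfOrthonormalOfCardEqFinrank hc (by simp)).toOrthonormalBasis (by simpa using hc)
  have hC : ∀ k, C k = c k := fun k => by simp [C]
  refine ⟨C, fun k => ⟨fun v => ?_, ?_⟩, fun k i => ?_⟩
  · rw [hC]
    exact Complex.ofReal_im _
  · obtain ⟨μ, hμ⟩ := (hb k).1
    refine ⟨μ, Module.End.mem_eigenspace_iff.2 ?_, C.orthonormal.ne_zero k⟩
    ext x
    rw [hC]
    have h := congrArg (fun r : ℝ => (r : ℂ)) (hμ x)
    change ∑ y, (if (CayleyQUE.cayleyGraph S).Adj x y then (1 : ℂ) else 0) * (b k y : ℂ)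
      = (μ : ℂ) * (b k x : ℂ)
    simpa [CayleyQUE.adjacencyMatrix, apply_ite] using h
  · rw [CayleyQUE.quantumMean_eq_sum, hC]
    simpa [c] using (hb k).2 i
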